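/- A loopless mixed graph on a node set $V$ has edges of three types, lines $i - j$, arrows $i\to j$ and arcs $i\leftrightarrow j$, each between two distinct nodes; edges of different types may join the same two nodes. A UG (undirected graph) has only lines, a BG (bidirected graph) has only arcs, and a DAG (directed acyclic graph) has only arrows and no cycle whose arrows all point in one direction around it. An RCG (regression chain graph) is a loopless mixed graph in which no node that is an endpoint of a line has an arrowhead (of an arrow or an arc) pointing to it, and which has no cycle that consists of arrows and arcs, contains at least one arrow, and whose arrows all point in one direction around the cycle. Cycles may have two nodes (two parallel edges). The inner node $t$ of a V-configuration $\langle i,t,j\rangle$ (a path with three nodes and two edges) is a collider if both edges have an arrowhead at $t$, and a non-collider otherwise; the V-configuration is unshielded if $i$ and $j$ are not adjacent. For pairwise disjoint $A,B,C\subseteq V$, write $A\perp_m B\mid C$ if there is no path between a node of $A$ and a node of $B$ such that all inner collider nodes of the path lie in $C\cup\mathrm{an}(C)$ and all inner non-collider nodes lie outside $C$, where $\mathrm{an}(C)$ is the set of nodes from which a directed path of arrows leads to a node of $C$. Two graphs on the same node set $V$ are Markov equivalent if, for all pairwise disjoint $A,B,C\subseteq V$, $A\perp_m B\mid C$ holds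 in one if and only if it holds in the other. Let $G_1$ and $G_2$ be two graphs on the same node set $V$, each of which is an RCG, a BG, a UG or a DAG (possibly of different types). Then $G_1$ and $G_2$ are Markov equivalent if and only if they have the same skeleton (the same pairs of adjacent nodes) and the same unshielded collider V-configurations, that is, the same node triples $\langle i,t,j\rangle$ that form an unshielded collider V-configuration. -/

import Mathlib

/-- A loopless mixed graph with node type `V`. Two distinct nodes may be joined by several edges of
different types: a line `i — j`, an arrow `i → j`, an arrow `j → i`, an arc `i ↔ j`. -/
structure LooplessMixedGraph (V : Type*) where
  /-- `line i j` : there is a (full) line between `i` and `j`. -/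
  line : V → V → Prop
  /-- `arrow i j` : there is an arrow from `i` to `j`. -/
  arrow : V → V → Prop
  /-- `arc i j` : there is an arc (two-headed arrow) between `i` and `j`. -/
  arc : V → V → Prop
  line_symm : ∀ i j, line i j → line j i
  arc_symm : ∀ i j, arc i j → arc j i
  line_irrefl : ∀ i, ¬ line i i
  arrow_irrefl : ∀ i, ¬ arrow i i
  arc_irrefl : ∀ i, ¬ arc i i

namespace LooplessMixedGraph

/-- The way in which an edge looks when a walk traverses it from `i` to `j`:
`line` is `i — j`, `forward` is `i → j`, `backward` is `i ← j`, `arc` is `i ↔ j`. -/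
inductive EdgeKind where
  | line
  | forward
  | backward
  | arc

/-- There is an arrowhead at the node that the traversed edge leads to. -/
def EdgeKind.HeadAtTarget : EdgeKind → Prop
  | .line => False
  | .forward => True
  | .backward => False
  | .arc => True

/-- There is an arrowhead at the node from which the traversed edge departs. -/
def EdgeKind.HeadAtSource : EdgeKind → Prop
  | .line => False
  | .forward => False
  | .backward => True
  | .arc => True

/-- The node between two consecutively traversed edges is a collider: both edges have an arrowhead
pointing to it, that is, the V-configuration is one of
`i → t ← j`, `i ↔ t ← j`, `i → t ↔ j`, `i ↔ t ↔ j`. -/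
def EdgeKind.Collide (e e' : EdgeKind) : Prop := e.HeadAtTarget ∧ e'.HeadAtSource

variable {V : Type*} (G : LooplessMixedGraph V)

/-- `G.IsEdge e i j` : `G` has an edge which, traversed from `i` to `j`, is of kind `e`. -/
def IsEdge : EdgeKind → V → V → Prop
  | .line, i, j => G.line i j
  | .forward, i, j => G.arrow i j
  | .backward, i, j => G.arrow j i
  | .arc, i, j => G.arc i j

/-- Adjacency of two nodes. -/
def Adj (i j : V) : Prop := ∃ e, G.IsEdge e i j

/-- The skeleton: every edge is replaced by an undirected edge. -/
def skeleton : SimpleGraph V where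
  Adj i j := G.Adj i j
  symm := ⟨by
    rintro i j ⟨e, h⟩
    cases e with
    | line => exact ⟨.line, G.line_symm _ _ h⟩
    | forward => exact ⟨.backward, h⟩
    | backward => exact ⟨.forward, h⟩
    | arc => exact ⟨.arc, G.arc_symm _ _ h⟩⟩
  loopless := ⟨by
    rintro i ⟨e, h⟩
    cases e with
    | line => exact G.line_irrefl i h
    | forward => exact G.arrow_irrefl i h
    | backward => exact G.arrow_irrefl i h
    | arc => exact G.arc_irrefl i h⟩

/-- The triples `⟨i, t, j⟩` which are the node sequence of an unshielded collider V-configuration: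
a path with three nodes and two edges whose inner node is a collider and whose endpoints are not
adjacent. -/
def unshieldedColliders : Set (V × V × V) :=
  {x | ∃ i t j : V, x = (i, t, j) ∧ i ≠ j ∧ ¬ G.Adj i j ∧
    ∃ e e', G.IsEdge e i t ∧ G.IsEdge e' t j ∧ e.Collide e'}

/-- There is an arrowhead pointing to the node `i`. -/
def HasArrowheadAt (i : V) : Prop := ∃ j, G.arrow j i ∨ G.arc j i

/-- A cycle consisting of arrows that all point in one direction around the cycle. Indices in
`Fin (n + 2)` are added cyclically; two parallel edges form a cycle with two nodes. -/
def HasDirectionPreservingCycle : Prop :=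
  ∃ (n : ℕ) (v : Fin (n + 2) → V), Function.Injective v ∧ ∀ k, G.arrow (v k) (v (k + 1))

/-- A cycle consisting of arrows and arcs, with at least one arrow, on which all the arrows point in
one direction around the cycle. -/
def HasArcDirectionPreservingCycle : Prop :=
  ∃ (n : ℕ) (v : Fin (n + 2) → V), Function.Injective v ∧
    (∀ k, G.arrow (v k) (v (k + 1)) ∨ G.arc (v k) (v (k + 1))) ∧
    ∃ k, G.arrow (v k) (v (k + 1))

/-- Regression chain graphs. -/
def IsRCG : Prop :=
  (∀ i j, G.line i j → ¬ G.HasArrowheadAt i) ∧ ¬ G.HasArcDirectionPreservingCycle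

/-- Bidirected graphs: all edges are arcs. -/
def IsBG : Prop := (∀ i j, ¬ G.line i j) ∧ ∀ i j, ¬ G.arrow i j

/-- Undirected graphs: all edges are lines. -/
def IsUG : Prop := (∀ i j, ¬ G.arrow i j) ∧ ∀ i j, ¬ G.arc i j

/-- Directed acyclic graphs: all edges are arrows and there is no direction-preserving cycle. -/
def IsDAG : Prop :=
  (∀ i j, ¬ G.line i j) ∧ (∀ i j, ¬ G.arc i j) ∧ ¬ G.HasDirectionPreservingCycle

/-- The ancestors of the members of `C`: the nodes from which a sequence of one or more arrows leads
to a member of `C`. -/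
def ancestors (C : Set V) : Set V := {j | ∃ i ∈ C, Relation.TransGen G.arrow j i}

/-- Walks from one node to another, recording the nodes and the edges that are used. -/
inductive Walk : V → V → Type _ where
  | nil (i : V) : Walk i i
  | cons {i j k : V} (e : EdgeKind) (h : G.IsEdge e i j) (p : Walk j k) : Walk i k

variable {G}

/-- The list of nodes of a walk. -/
def Walk.support : {i j : V} → G.Walk i j → List V
  | i, _, .nil _ => [i]
  | i, _, .cons _ _ p => i :: p.support

/-- A path is a walk without repeated nodes (hence, as there are no loops, without repeated
edges). -/
def Walk.IsPath {i j : V} (p : G.Walk i j) : Prop := p.support.Nodup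

/-- All inner nodes that are colliders on the walk are in `C ∪ an(C)`, and all inner nodes that are
non-colliders on the walk are outside `C`. -/
def Walk.IsOpen (C : Set V) : {i j : V} → G.Walk i j → Prop
  | _, _, .nil _ => True
  | _, _, .cons _ _ (.nil _) => True
  | _, _, .cons (j := t) e _ (.cons e' h' p) =>
      (e.Collide e' → t ∈ C ∪ G.ancestors C) ∧ (¬ e.Collide e' → t ∉ C) ∧
        (Walk.cons e' h' p).IsOpen C

/-- An `m`-connecting path given `C`. -/
def Walk.IsMConnecting (C : Set V) {i j : V} (p : G.Walk i j) : Prop := p.IsPath ∧ p.IsOpen C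

variable (G)

/-- `A` and `B` are `m`-separated given `C` (meaningful for pairwise disjoint sets): there is no
`m`-connecting path between a node of `A` and a node of `B` given `C`. -/
def MSeparated (A B C : Set V) : Prop :=
  ∀ i ∈ A, ∀ j ∈ B, ¬ ∃ p : G.Walk i j, p.IsMConnecting C

/-- Two graphs with the same node set are Markov equivalent if they have the same
`m`-separations. -/
def MarkovEquivalent (G₁ G₂ : LooplessMixedGraph V) : Prop :=
  ∀ A B C : Set V, Disjoint A B → Disjoint A C → Disjoint B C →
    (G₁.MSeparated A B C ↔ G₂.MSeparated A B C)

end LooplessMixedGraph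

/-! BGs, UGs and DAGs are RCGs, so only RCGs matter. In an RCG the arrowheads of an edge are
determined by its two nodes (`IsRCG.headAtTarget_iff`, `IsRCG.headAtSource_iff`), so m-connecting
paths can be handled as lists of nodes.

Markov equivalence determines the data: nonadjacent `i`, `j` are separated by their anteriors
(`IsRCG.mSeparated_anteriors`), adjacent nodes by nothing. An unshielded collider `t` between `i`
and `j` is not anterior to them, so if it were a non-collider in the other graph, `i, t, j` would be
open there.

Conversely, among the open paths of `G₁` take one minimizing the sum of `depth + 1`, the depth being
the arrow distance to `C`. The same list of nodes is open in `G₂`. Unshielded inner nodes keep their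
status by hypothesis. A shielded inner node is a non-collider by minimality, and remains one by an
argument along discriminating paths (`SameVees.arrow_or_shortcut`). If a collider `t ∉ C` starts a
shortest chain `t → d → ⋯` into `C`, then `t → d` survives in `G₂`, since otherwise both arms of the
path could be rerouted to the lighter node `d`; the rest of the chain survives because a shortest
chain is unshielded. -/

namespace LooplessMixedGraph

open Relation

/-! ### Arrowheads and cycles in regression chain graphs -/

section Basic

variable {V : Type*} {G : LooplessMixedGraph V}

variable (G) in
/-- There is an edge between `x` and `y` with an arrowhead at `y`. -/
def Points (x y : V) : Prop := G.arrow x y ∨ G.arc x y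

theorem Adj.symm {x y : V} (h : G.Adj x y) : G.Adj y x := G.skeleton.adj_symm h

theorem Adj.ne {x y : V} (h : G.Adj x y) : x ≠ y := G.skeleton.ne_of_adj h

theorem Points.adj {x y : V} (h : G.Points x y) : G.Adj x y := by
  rcases h with h | h
  · exact ⟨.forward, h⟩
  · exact ⟨.arc, h⟩

theorem adj_of_arrow {x y : V} (h : G.arrow x y) : G.Adj x y := ⟨.forward, h⟩

theorem Adj.cases {x y : V} (h : G.Adj x y) :
    G.line x y ∨ G.arrow x y ∨ G.Points y x := by
  obtain ⟨e, h⟩ := h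
  cases e with
  | line => exact .inl h
  | forward => exact .inr (.inl h)
  | backward => exact .inr (.inr (.inl h))
  | arc => exact .inr (.inr (.inr (G.arc_symm _ _ h)))

theorem IsRCG.not_points_of_line (hG : G.IsRCG) {x y z : V} (h : G.line x y) : ¬ G.Points z x :=
  fun hz => hG.1 x y h ⟨z, hz⟩

theorem exists_nodup_isChain {r : V → V → Prop} {x y : V} (h : ReflTransGen r x y) :
    ∃ l : List V, (x :: l).Nodup ∧ (x :: l).IsChain r ∧ (x :: l).getLast? = some y := by
  induction h using ReflTransGen.head_induction_on with
  | refl => exact ⟨[], by simp⟩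
  | @head a c hac _ ih =>
    obtain ⟨l, hn, hc, hl⟩ := ih
    by_cases ha : a ∈ c :: l
    · obtain ⟨P, Q, hPQ⟩ := List.append_of_mem ha
      rw [hPQ] at hn hc hl
      refine ⟨Q, hn.of_append_right, hc.right_of_append, ?_⟩
      simpa using hl
    · refine ⟨c :: l, List.nodup_cons.2 ⟨ha, hn⟩, ?_, ?_⟩
      · exact List.IsChain.cons_cons hac hc
      · rw [List.getLast?_cons_cons, hl]

/-- The form in which acyclicity is used: loops are cut out of the return walk, so it need not be
injective. -/
theorem IsRCG.false_of_cycle (hG : G.IsRCG) {x y : V} (h : G.arrow x y)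
    (hp : ReflTransGen G.Points y x) : False := by
  obtain ⟨l, hn, hc, hl⟩ := exists_nodup_isChain hp
  match l with
  | [] =>
    simp only [List.getLast?_singleton, Option.some.injEq] at hl
    subst hl
    exact G.arrow_irrefl _ h
  | z :: l =>
    have hlast : (y :: z :: l)[l.length + 1] = x := by
      rw [List.getLast?_eq_getElem?] at hl
      simpa using hl
    refine hG.2 ⟨l.length, fun k => (y :: z :: l)[k.1], ?_, ?_, Fin.last _, ?_⟩
    · intro a b hab
      exact Fin.ext ((hn.getElem_inj_iff).1 hab)
    · intro k
      -- The last index wraps around to `0`; there the edge is the closing arrow `x → y`.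
      rcases Fin.eq_castSucc_or_eq_last k with ⟨k, rfl⟩ | rfl
      · have := List.isChain_iff_getElem.1 hc k.1 (by have := k.2; simp; omega)
        simpa [Points, Fin.coeSucc_eq_succ] using this
      · left
        simp only [Fin.last_add_one, Fin.val_last, hlast]
        exact h
    · simp only [Fin.last_add_one, Fin.val_last, hlast]
      exact h

theorem IsRCG.not_points_of_arrow (hG : G.IsRCG) {x y : V} (h : G.arrow x y) : ¬ G.Points y x :=
  fun h' => hG.false_of_cycle h (.single h')

theorem IsRCG.points_of_not_arrow (hG : G.IsRCG) {s x y : V} (hs : G.Points s x) (h : G.Adj x y)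
    (ha : ¬ G.arrow x y) : G.Points y x := by
  rcases h.cases with h | h | h
  · exact absurd hs (hG.not_points_of_line h)
  · exact absurd h ha
  · exact h

/-- The third edge of a triangle with two sides `x *→ t → d` is `x → d`. -/
theorem IsRCG.arrow_of_triangle (hG : G.IsRCG) {x t d : V} (hx : G.Points x t) (ht : G.arrow t d)
    (h : G.Adj x d) : G.arrow x d := by
  by_contra hn
  rcases h.cases with h | h | h
  · exact hG.not_points_of_line (G.line_symm _ _ h) (.inl ht)
  · exact hn h
  · exact hG.false_of_cycle ht (.head h (.single hx))

theorem IsRCG.headAtTarget_iff (hG : G.IsRCG) {e : EdgeKind} {x y : V} (h : G.IsEdge e x y) :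
    e.HeadAtTarget ↔ G.Points x y := by
  cases e with
  | line =>
    exact ⟨False.elim, hG.not_points_of_line (G.line_symm _ _ h)⟩
  | forward => exact ⟨fun _ => .inl h, fun _ => trivial⟩
  | backward => exact ⟨False.elim, hG.not_points_of_arrow h⟩
  | arc => exact ⟨fun _ => .inr h, fun _ => trivial⟩

theorem IsRCG.headAtSource_iff (hG : G.IsRCG) {e : EdgeKind} {x y : V} (h : G.IsEdge e x y) :
    e.HeadAtSource ↔ G.Points y x := by
  cases e with
  | line => exact ⟨False.elim, hG.not_points_of_line h⟩
  | forward => exact ⟨False.elim, hG.not_points_of_arrow h⟩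
  | backward => exact ⟨fun _ => .inl h, fun _ => trivial⟩
  | arc => exact ⟨fun _ => .inr (G.arc_symm _ _ h), fun _ => trivial⟩

theorem Points.exists_edge {x y : V} (h : G.Points x y) :
    ∃ e, G.IsEdge e x y ∧ e.HeadAtTarget := by
  rcases h with h | h
  · exact ⟨.forward, h, trivial⟩
  · exact ⟨.arc, h, trivial⟩

theorem Points.exists_edge_symm {x y : V} (h : G.Points x y) :
    ∃ e, G.IsEdge e y x ∧ e.HeadAtSource := by
  rcases h with h | h
  · exact ⟨.backward, h, trivial⟩
  · exact ⟨.arc, G.arc_symm _ _ h, trivial⟩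

theorem IsRCG.mem_unshieldedColliders (hG : G.IsRCG) {i t j : V} :
    (i, t, j) ∈ G.unshieldedColliders ↔
      i ≠ j ∧ ¬ G.Adj i j ∧ G.Points i t ∧ G.Points j t := by
  constructor
  · rintro ⟨i, t, j, h, hij, hadj, e, e', he, he', hc, hc'⟩
    obtain ⟨rfl, rfl, rfl⟩ : _ ∧ _ ∧ _ := by simpa using h
    exact ⟨hij, hadj, (hG.headAtTarget_iff he).1 hc, (hG.headAtSource_iff he').1 hc'⟩
  · rintro ⟨hij, hadj, hi, hj⟩
    obtain ⟨e, he, hc⟩ := hi.exists_edge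
    obtain ⟨e', he', hc'⟩ := hj.exists_edge_symm
    exact ⟨i, t, j, rfl, hij, hadj, e, e', he, he', hc, hc'⟩

theorem IsBG.isRCG (h : G.IsBG) : G.IsRCG :=
  ⟨fun i j hl => absurd hl (h.1 i j), fun ⟨_, _, _, _, _, hk⟩ => h.2 _ _ hk⟩

theorem IsUG.isRCG (h : G.IsUG) : G.IsRCG :=
  ⟨fun i _ _ ⟨j, hj⟩ => hj.elim (h.1 j i) (h.2 j i), fun ⟨_, _, _, _, _, hk⟩ => h.1 _ _ hk⟩

theorem IsDAG.isRCG (h : G.IsDAG) : G.IsRCG :=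
  ⟨fun i j hl => absurd hl (h.1 i j), fun ⟨n, v, hv, hk, _⟩ =>
    h.2.2 ⟨n, v, hv, fun k => (hk k).resolve_right (h.2.1 _ _)⟩⟩

end Basic

/-! ### Open paths as lists of nodes -/

section Paths

variable {V : Type*} (G : LooplessMixedGraph V) (C : Set V)

/-- The inner node `t` of the V-configuration `⟨a, t, b⟩` does not block given `C`. -/
def OpenAt (a t b : V) : Prop :=
  (G.Points a t ∧ G.Points b t → t ∈ C ∪ G.ancestors C) ∧
    (¬ (G.Points a t ∧ G.Points b t) → t ∉ C)

/-- `x :: L` is the list of nodes of a walk from `x` to `i`, all of whose inner nodes are open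
given `C`. -/
def OpenWalk (i : V) : V → List V → Prop
  | x, [] => x = i
  | x, a :: L => G.Adj x a ∧ (∀ z ∈ L.head?, G.OpenAt C x a z) ∧ OpenWalk i a L

/-- `L.reverse ++ t :: R` is the list of nodes of an open path from `i` to `j`. -/
structure OpenPath (i j : V) (t : V) (L R : List V) : Prop where
  left : G.OpenWalk C i t L
  right : G.OpenWalk C j t R
  openAt : ∀ a ∈ L.head?, ∀ b ∈ R.head?, G.OpenAt C a t b
  nodup : (t :: (L ++ R)).Nodup

variable {G C} {i j t a b : V} {L R : List V}

theorem OpenAt.symm (h : G.OpenAt C a t b) : G.OpenAt C b t a :=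
  ⟨fun hc => h.1 hc.symm, fun hc => h.2 fun hc' => hc hc'.symm⟩

theorem OpenPath.symm (h : G.OpenPath C i j t L R) : G.OpenPath C j i t R L where
  left := h.right
  right := h.left
  openAt b hb a ha := (h.openAt a ha b hb).symm
  nodup := (List.Perm.cons t List.perm_append_comm).nodup_iff.1 h.nodup

/-- Same path, new base node: with `symm`, a local argument at the base node applies at every node
of the path. -/
theorem OpenPath.shift (h : G.OpenPath C i j t L (b :: R)) : G.OpenPath C i j b (t :: L) R where
  left := ⟨h.right.1.symm, fun z hz => (h.openAt z hz b rfl).symm, h.left⟩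
  right := h.right.2.2
  openAt a ha z hz := by
    obtain rfl : t = a := by simpa using ha
    exact h.right.2.1 z hz
  nodup := by
    refine (List.Perm.nodup_iff ?_).1 h.nodup
    exact (List.Perm.cons t List.perm_middle).trans (List.Perm.swap _ _ _)

theorem OpenPath.shift_left (h : G.OpenPath C i j t (a :: L) R) : G.OpenPath C i j a L (t :: R) :=
  h.symm.shift.symm

theorem OpenPath.ne (h : G.OpenPath C i j t (a :: L) (b :: R)) : a ≠ b := by
  rintro rfl
  have := h.nodup
  simp at this

theorem OpenWalk.of_append {P : List V} {x : V} (h : G.OpenWalk C i x (P ++ t :: L)) :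
    G.OpenWalk C i t L ∧ (t ∈ C → ∀ y ∈ L.head?, G.Points y t) := by
  induction P generalizing x with
  | nil =>
    refine ⟨h.2.2, fun ht y hy => ?_⟩
    by_contra hn
    exact (h.2.1 y hy).2 (fun hc => hn hc.2) ht
  | cons p P ih => exact ih h.2.2

/-- If `t` recurs, keep only what follows it. When `t ∈ C`, its inner occurrence is a collider,
which supplies the arrowhead at `t` again. -/
theorem OpenWalk.exists_notMem (h : G.OpenWalk C i t L) (hp : ∀ y ∈ L.head?, G.Points y t)
    (hn : L.Nodup) :
    ∃ Q, Q.Sublist L ∧ G.OpenWalk C i t Q ∧ t ∉ Q ∧ (t ∈ C → ∀ y ∈ Q.head?, G.Points y t) := by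
  by_cases ht : t ∈ L
  · obtain ⟨P, Q, rfl⟩ := List.append_of_mem ht
    have hQ := h.of_append
    refine ⟨Q, ?_, hQ.1, (List.nodup_cons.1 hn.of_append_right).1, hQ.2⟩
    exact (List.sublist_cons_self _ _).trans (List.sublist_append_right _ _)
  · exact ⟨L, List.Sublist.refl _, h, ht, fun _ => hp⟩

theorem OpenWalk.mem_end (h : G.OpenWalk C i t L) : i ∈ t :: L := by
  induction L generalizing t with
  | nil =>
    obtain rfl : t = i := h
    simp
  | cons a L ih => exact List.mem_cons_of_mem _ (ih h.2.2)

/-- The last conjunct strengthens the induction: it gives openness at `x` once an edge is put in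
front. -/
theorem Walk.exists_openWalk (hG : G.IsRCG) {x y : V} (p : G.Walk x y) (h : p.IsOpen C) :
    ∃ L, p.support = x :: L ∧ G.OpenWalk C y x L ∧
      (∀ e z k (he : G.IsEdge e z x), (Walk.cons e he p).IsOpen C → k ∈ L.head? →
        G.OpenAt C z x k) := by
  induction p with
  | nil x => exact ⟨[], rfl, rfl, by simp⟩
  | @cons x a y e he p ih =>
    have hp : p.IsOpen C := by
      cases p with
      | nil => trivial
      | cons => exact h.2.2
    obtain ⟨L, hs, hL, hz⟩ := ih hp
    refine ⟨a :: L, by rw [Walk.support, hs], ⟨⟨e, he⟩, fun z hzL => hz e x z he h hzL, hL⟩, ?_⟩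
    intro e₀ z k he₀ hp₀ hk
    obtain rfl : a = k := by simpa using hk
    have := hp₀
    simp only [Walk.IsOpen, EdgeKind.Collide, hG.headAtTarget_iff he₀,
      hG.headAtSource_iff he] at this
    exact ⟨this.1, this.2.1⟩

theorem OpenWalk.exists_walk (hG : G.IsRCG) {x y : V} (h : G.OpenWalk C y x L) :
    ∃ p : G.Walk x y, p.support = x :: L ∧ p.IsOpen C := by
  induction L generalizing x with
  | nil =>
    obtain rfl : x = y := h
    exact ⟨.nil x, rfl, trivial⟩
  | cons a L ih =>
    obtain ⟨⟨e, he⟩, hz, hL⟩ := h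
    obtain ⟨p, hp, ho⟩ := ih hL
    refine ⟨.cons e he p, by rw [Walk.support, hp], ?_⟩
    cases p with
    | nil => trivial
    | @cons _ c _ e' he' p =>
      have hc : c ∈ L.head? := by
        rw [Walk.support, List.cons.injEq] at hp
        rw [← hp.2]
        cases p <;> simp [Walk.support]
      have := hz c hc
      refine ⟨?_, ?_, ho⟩
      · simpa only [EdgeKind.Collide, hG.headAtTarget_iff he, hG.headAtSource_iff he'] using this.1
      · simpa only [EdgeKind.Collide, hG.headAtTarget_iff he, hG.headAtSource_iff he'] using this.2

theorem IsRCG.exists_isMConnecting_iff (hG : G.IsRCG) :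
    (∃ p : G.Walk i j, p.IsMConnecting C) ↔ ∃ R, G.OpenPath C i j i [] R := by
  constructor
  · rintro ⟨p, hp, ho⟩
    obtain ⟨R, hs, hR, -⟩ := p.exists_openWalk hG ho
    rw [Walk.IsPath, hs] at hp
    exact ⟨R, rfl, hR, by simp, hp⟩
  · rintro ⟨R, hR⟩
    obtain ⟨p, hs, ho⟩ := hR.right.exists_walk hG
    refine ⟨p, ?_, ho⟩
    rw [Walk.IsPath, hs]
    exact hR.nodup

end Paths

/-! ### Separation by anteriors; Markov equivalence determines skeleton and unshielded colliders -/

section Separation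

variable {V : Type*} (G : LooplessMixedGraph V)

/-- The nodes other than `i` and `j` from which a walk of lines and arrows, the latter all pointing
forward, leads to `i` or `j`. -/
def anteriors (i j : V) : Set V :=
  {x | x ≠ i ∧ x ≠ j ∧
    (ReflTransGen (fun a b => G.line a b ∨ G.arrow a b) x i ∨
      ReflTransGen (fun a b => G.line a b ∨ G.arrow a b) x j)}

variable {G} {i j t a b x : V} {L R : List V}

theorem anteriors_comm : G.anteriors i j = G.anteriors j i := by
  ext x
  simp only [anteriors, Set.mem_ofPred_eq]
  tauto

theorem mem_closure_iff {C : Set V} :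
    x ∈ C ∪ G.ancestors C ↔ ∃ c ∈ C, ReflTransGen G.arrow x c := by
  constructor
  · rintro (h | ⟨c, hc, h⟩)
    · exact ⟨x, h, .refl⟩
    · exact ⟨c, hc, h.to_reflTransGen⟩
  · rintro ⟨c, hc, h⟩
    rcases reflTransGen_iff_eq_or_transGen.1 h with rfl | h
    · exact .inl hc
    · exact .inr ⟨c, hc, h⟩

theorem anterior_of_mem_closure (h : x ∈ G.anteriors i j ∪ G.ancestors (G.anteriors i j)) :
    ReflTransGen (fun a b => G.line a b ∨ G.arrow a b) x i ∨
      ReflTransGen (fun a b => G.line a b ∨ G.arrow a b) x j := by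
  obtain ⟨c, hc, h⟩ := mem_closure_iff.1 h
  have h' : ReflTransGen (fun a b => G.line a b ∨ G.arrow a b) x c :=
    ReflTransGen.mono (fun _ _ => .inr) _ _ h
  exact hc.2.2.imp h'.trans h'.trans

/-- No line meets a node with an arrowhead, so from `x` on the walk consists of arrows only. -/
theorem IsRCG.reflTransGen_points (hG : G.IsRCG) (hx : G.Points a x)
    (h : ReflTransGen (fun a b => G.line a b ∨ G.arrow a b) x t) (hne : x ≠ t) :
    ∃ y, G.arrow x y ∧ ReflTransGen G.Points y t := by
  have key : ReflTransGen G.arrow x t := by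
    clear hne
    induction h using ReflTransGen.head_induction_on generalizing a with
    | refl => exact .refl
    | @head x c hxc _ ih =>
      have hxc := hxc.resolve_left fun hl => hG.not_points_of_line hl hx
      exact .head hxc (ih (.inl hxc))
  rcases ReflTransGen.cases_head key with h | ⟨y, hy, h⟩
  · exact absurd h hne
  · exact ⟨y, hy, ReflTransGen.mono (fun _ _ => .inl) _ _ h⟩

/-- Leave `x` along the walk by lines and forward arrows until the end `i` or a collider is met; an
open collider leads on to `i` or `j`. -/
theorem IsRCG.anterior_of_openWalk (hG : G.IsRCG) (hL : G.OpenWalk (G.anteriors i j) i x (a :: L))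
    (hx : ¬ G.Points a x) :
    ReflTransGen (fun a b => G.line a b ∨ G.arrow a b) x i ∨
      ReflTransGen (fun a b => G.line a b ∨ G.arrow a b) x j := by
  induction L generalizing x a with
  | nil =>
    obtain rfl : a = i := hL.2.2
    rcases hL.1.cases with h | h | h
    · exact .inl (.single (.inl h))
    · exact .inl (.single (.inr h))
    · exact absurd h hx
  | cons z L ih =>
    have hxa : G.line x a ∨ G.arrow x a := by
      rcases hL.1.cases with h | h | h
      · exact .inl h
      · exact .inr h
      · exact absurd h hx
    suffices ReflTransGen (fun a b => G.line a b ∨ G.arrow a b) a i ∨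
        ReflTransGen (fun a b => G.line a b ∨ G.arrow a b) a j from
      this.imp (.head hxa) (.head hxa)
    by_cases hz : G.Points z a
    · rcases hxa with h | h
      · exact absurd hz (hG.not_points_of_line (G.line_symm _ _ h))
      · exact anterior_of_mem_closure ((hL.2.1 z rfl).1 ⟨.inl h, hz⟩)
    · exact ih hL.2.2 hz

theorem IsRCG.anterior_of_openPath (hG : G.IsRCG)
    (h : G.OpenPath (G.anteriors i j) i j t (a :: L) (b :: R)) :
    t ∈ G.anteriors i j := by
  have hti : t ≠ i := by
    rintro rfl
    have h1 := h.left.2.2.mem_end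
    have h2 := h.nodup
    simp only [List.cons_append, List.nodup_cons, List.mem_cons, List.mem_append] at h1 h2
    tauto
  have htj : t ≠ j := by
    rintro rfl
    have h1 := h.right.2.2.mem_end
    have h2 := h.nodup
    simp only [List.cons_append, List.nodup_cons, List.mem_cons, List.mem_append] at h1 h2
    tauto
  refine ⟨hti, htj, ?_⟩
  by_cases ha : G.Points a t
  · by_cases hb : G.Points b t
    · exact anterior_of_mem_closure ((h.openAt a rfl b rfl).1 ⟨ha, hb⟩)
    · have := h.right
      rw [anteriors_comm] at this
      exact (hG.anterior_of_openWalk this hb).symm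
  · exact hG.anterior_of_openWalk h.left ha

/-- Every inner node is anterior, hence in the conditioning set, where a non-collider would block.
-/
theorem IsRCG.collider_of_openPath (hG : G.IsRCG)
    (h : G.OpenPath (G.anteriors i j) i j t (a :: L) (b :: R)) :
    G.Points a t ∧ G.Points b t := by
  by_contra hn
  exact (h.openAt a rfl b rfl).2 hn (hG.anterior_of_openPath h)

theorem IsRCG.reflTransGen_of_openPath (hG : G.IsRCG)
    (h : G.OpenPath (G.anteriors i j) i j t (a :: L) (b :: R)) :
    ReflTransGen G.Points j t := by
  induction R generalizing t a b L with
  | nil =>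
    obtain rfl : b = j := h.right.2.2
    exact .single (hG.collider_of_openPath h).2
  | cons c R ih => exact (ih h.shift).tail (hG.collider_of_openPath h).2

theorem IsRCG.not_openPath_anteriors (hG : G.IsRCG) (hij : i ≠ j) (hadj : ¬ G.Adj i j) :
    ¬ G.OpenPath (G.anteriors i j) i j i [] R := by
  intro h
  match R with
  | [] => exact hij h.right
  | [b] =>
    obtain rfl : b = j := h.right.2.2
    exact hadj h.right.1
  -- The first inner node `t` has arrows leading to `i` or `j`. Since all inner nodes are colliders,
  -- arrowheads lead back to `t` from either end, closing a forbidden cycle.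
  | t :: b :: R =>
    have h' := h.shift
    have ht := hG.anterior_of_openPath h'
    have hc := hG.collider_of_openPath h'
    rcases ht.2.2 with hr | hr
    · obtain ⟨y, hy, hr⟩ := hG.reflTransGen_points hc.1 hr ht.1
      exact hG.false_of_cycle hy (hr.tail hc.1)
    · obtain ⟨y, hy, hr⟩ := hG.reflTransGen_points hc.1 hr ht.2.1
      exact hG.false_of_cycle hy (hr.trans (hG.reflTransGen_of_openPath h'))

theorem IsRCG.mSeparated_anteriors (hG : G.IsRCG) (hij : i ≠ j) (hadj : ¬ G.Adj i j) :
    G.MSeparated {i} {j} (G.anteriors i j) := by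
  rintro _ rfl _ rfl h
  obtain ⟨R, hR⟩ := hG.exists_isMConnecting_iff.1 h
  exact hG.not_openPath_anteriors hij hadj hR

theorem not_mSeparated_of_adj {C : Set V} (h : G.Adj i j) : ¬ G.MSeparated {i} {j} C := by
  intro hs
  obtain ⟨e, he⟩ := h
  refine hs i rfl j rfl ⟨.cons e he (.nil j), ?_, trivial⟩
  simp [Walk.IsPath, Walk.support, Adj.ne ⟨e, he⟩]

variable {G₁ G₂ : LooplessMixedGraph V}

theorem MarkovEquivalent.symm (h : MarkovEquivalent G₁ G₂) : MarkovEquivalent G₂ G₁ :=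
  fun A B C h₁ h₂ h₃ => (h A B C h₁ h₂ h₃).symm

theorem MarkovEquivalent.mSeparated_anteriors (h : MarkovEquivalent G₁ G₂) (h₁ : G₁.IsRCG)
    (hij : i ≠ j) (hadj : ¬ G₁.Adj i j) : G₂.MSeparated {i} {j} (G₁.anteriors i j) := by
  refine (h {i} {j} _ ?_ ?_ ?_).1 (h₁.mSeparated_anteriors hij hadj)
  · simpa using hij
  · simp [anteriors]
  · simp [anteriors]

theorem MarkovEquivalent.adj (h : MarkovEquivalent G₁ G₂) (h₁ : G₁.IsRCG) (hadj : G₂.Adj i j) :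
    G₁.Adj i j := by
  by_contra hn
  exact not_mSeparated_of_adj hadj (h.mSeparated_anteriors h₁ hadj.ne hn)

theorem MarkovEquivalent.unshieldedColliders_subset (h : MarkovEquivalent G₁ G₂) (h₁ : G₁.IsRCG)
    (h₂ : G₂.IsRCG) : G₁.unshieldedColliders ⊆ G₂.unshieldedColliders := by
  rintro ⟨i, t, j⟩ hx
  obtain ⟨hij, hadj, hi, hj⟩ := h₁.mem_unshieldedColliders.1 hx
  refine h₂.mem_unshieldedColliders.2 ⟨hij, fun hn => hadj (h.adj h₁ hn), ?_⟩
  by_contra hn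
  refine h.mSeparated_anteriors h₁ hij hadj i rfl j rfl (h₂.exists_isMConnecting_iff.2 ⟨[t, j], ?_⟩)
  have ht : t ∉ G₁.anteriors i j := by
    rintro ⟨hti, htj, hr | hr⟩
    · obtain ⟨y, hy, hr⟩ := h₁.reflTransGen_points hi hr hti
      exact h₁.false_of_cycle hy (hr.tail hi)
    · obtain ⟨y, hy, hr⟩ := h₁.reflTransGen_points hi hr htj
      exact h₁.false_of_cycle hy (hr.tail hj)
  refine ⟨rfl, ⟨h.symm.adj h₂ hi.adj, ?_, h.symm.adj h₂ hj.adj.symm, by simp, rfl⟩, by simp, ?_⟩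
  · rintro z hz
    obtain rfl : j = z := by simpa using hz
    exact ⟨fun hc => absurd hc hn, fun _ => ht⟩
  · simp [hij, hi.adj.ne, hj.adj.ne.symm]

end Separation

/-! ### Open paths of least weight -/

section Minimal

variable {V : Type*} (G : LooplessMixedGraph V) (C : Set V)

/-- A sequence of `n` arrows leads from the node to a member of `C`. -/
inductive ReachesIn : ℕ → V → Prop
  | zero {x : V} : x ∈ C → ReachesIn 0 x
  | succ {n : ℕ} {x y : V} : G.arrow x y → ReachesIn n y → ReachesIn (n + 1) x

/-- The least number of arrows leading from `x` to a member of `C` (`0` if there is none). -/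
noncomputable def depth (x : V) : ℕ := sInf {n | G.ReachesIn C n x}

/-- The total weight of a list of nodes, a node `x` having weight `depth x + 1`. -/
noncomputable def weight (l : List V) : ℕ := (l.map fun x => G.depth C x + 1).sum

/-- An open path whose weight is least among the open paths from `i` to `j`. -/
structure MinPath (i j : V) (t : V) (L R : List V) : Prop extends G.OpenPath C i j t L R where
  le : ∀ t' L' R', G.OpenPath C i j t' L' R' →
    G.weight C (t :: (L ++ R)) ≤ G.weight C (t' :: (L' ++ R'))

variable {G C} {i j t a b d x z : V} {L R : List V}

theorem mem_closure_iff_reachesIn : x ∈ C ∪ G.ancestors C ↔ ∃ n, G.ReachesIn C n x := by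
  rw [mem_closure_iff]
  constructor
  · rintro ⟨c, hc, h⟩
    induction h using ReflTransGen.head_induction_on with
    | refl => exact ⟨0, .zero hc⟩
    | head h _ ih =>
      obtain ⟨n, hn⟩ := ih
      exact ⟨n + 1, .succ h hn⟩
  · rintro ⟨n, hn⟩
    induction hn with
    | zero h => exact ⟨_, h, .refl⟩
    | succ h _ ih =>
      obtain ⟨c, hc, h'⟩ := ih
      exact ⟨c, hc, .head h h'⟩

theorem mem_closure_of_arrow (h : G.arrow x t) (ht : t ∈ C ∪ G.ancestors C) :
    x ∈ C ∪ G.ancestors C := by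
  obtain ⟨n, hn⟩ := mem_closure_iff_reachesIn.1 ht
  exact mem_closure_iff_reachesIn.2 ⟨n + 1, .succ h hn⟩

theorem reachesIn_depth (hx : x ∈ C ∪ G.ancestors C) : G.ReachesIn C (G.depth C x) x :=
  Nat.sInf_mem (mem_closure_iff_reachesIn.1 hx)

theorem depth_le {n : ℕ} (h : G.ReachesIn C n x) : G.depth C x ≤ n := Nat.sInf_le h

theorem depth_le_of_arrow (h : G.arrow x t) (ht : t ∈ C ∪ G.ancestors C) :
    G.depth C x ≤ G.depth C t + 1 := depth_le (.succ h (reachesIn_depth ht))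

theorem exists_arrow_depth (hx : x ∈ C ∪ G.ancestors C) (hC : x ∉ C) :
    ∃ y, G.arrow x y ∧ y ∈ C ∪ G.ancestors C ∧ G.depth C x = G.depth C y + 1 := by
  have h := reachesIn_depth hx
  generalize hn : G.depth C x = n at h
  cases h with
  | zero h => exact absurd h hC
  | @succ n _ y h hy =>
    have hy' : y ∈ C ∪ G.ancestors C := mem_closure_iff_reachesIn.2 ⟨n, hy⟩
    exact ⟨y, h, hy', le_antisymm (hn ▸ depth_le_of_arrow h hy') (by simpa using depth_le hy)⟩

theorem weight_cons {l : List V} : G.weight C (x :: l) = G.depth C x + 1 + G.weight C l := by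
  simp [weight]

theorem weight_append {l l' : List V} :
    G.weight C (l ++ l') = G.weight C l + G.weight C l' := by
  simp [weight]

theorem weight_le_of_sublist {l l' : List V} (h : l.Sublist l') :
    G.weight C l ≤ G.weight C l' :=
  (h.map _).sum_le_sum (by simp)

theorem MinPath.symm (h : G.MinPath C i j t L R) : G.MinPath C j i t R L where
  toOpenPath := h.toOpenPath.symm
  le t' L' R' h' := by
    have := h.le t' R' L' h'.symm
    simp only [weight_cons, weight_append] at this ⊢
    omega

theorem MinPath.shift (h : G.MinPath C i j t L (b :: R)) : G.MinPath C i j b (t :: L) R where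
  toOpenPath := h.toOpenPath.shift
  le t' L' R' h' := by
    have := h.le t' L' R' h'
    simp only [weight_cons, weight_append, List.cons_append] at this ⊢
    omega

theorem MinPath.shift_left (h : G.MinPath C i j t (a :: L) R) : G.MinPath C i j a L (t :: R) :=
  h.symm.shift.symm

theorem OpenPath.exists_minPath (h : G.OpenPath C i j t L R) :
    ∃ t' L' R', G.MinPath C i j t' L' R' := by
  classical
  have hex : ∃ n t' L' R', G.OpenPath C i j t' L' R' ∧ G.weight C (t' :: (L' ++ R')) = n :=
    ⟨_, t, L, R, h, rfl⟩
  obtain ⟨t', L', R', h', hw⟩ := Nat.find_spec hex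
  refine ⟨t', L', R', h', fun t'' L'' R'' h'' => ?_⟩
  rw [hw]
  exact Nat.find_min' hex ⟨t'', L'', R'', h'', rfl⟩

/-- Describes how skipping `t` can block `a`. If `a` became a collider outside the closure of `C`,
then `a → t` with `t` an open collider, which puts `a` in that closure after all. So `a` turns from
a collider into a non-collider in `C`. -/
theorem IsRCG.of_not_openAt (hG : G.IsRCG) (hz : G.OpenAt C z a t) (ht : G.OpenAt C a t b)
    (hat : G.Adj a t) (htb : G.Adj t b) (hab : G.Adj a b) (h : ¬ G.OpenAt C z a b) :
    G.Points z a ∧ G.Points t a ∧ G.arrow a b ∧ a ∈ C := by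
  by_cases hc : G.Points z a ∧ G.Points b a
  · have ha : a ∉ C ∪ G.ancestors C := fun ha => h ⟨fun _ => ha, fun hn => absurd hc hn⟩
    have hta : ¬ G.Points t a := fun hta => ha (hz.1 ⟨hc.1, hta⟩)
    have hat' : G.arrow a t := by
      by_contra hn
      exact hta (hG.points_of_not_arrow hc.1 hat hn)
    have hbt : G.Points b t := by
      refine hG.points_of_not_arrow (.inl hat') htb fun hn => ?_
      exact hG.false_of_cycle hat' (.head (.inl hn) (.single hc.2))
    exact absurd (mem_closure_of_arrow hat' (ht.1 ⟨.inl hat', hbt⟩)) ha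
  · have ha : a ∈ C := by
      by_contra ha
      exact h ⟨fun hn => absurd hn hc, fun _ => ha⟩
    have hzt : G.Points z a ∧ G.Points t a := by
      by_contra hn
      exact hz.2 hn ha
    refine ⟨hzt.1, hzt.2, ?_, ha⟩
    by_contra hn
    exact hc ⟨hzt.1, hG.points_of_not_arrow hzt.1 hab hn⟩

/-- If the neighbours of `t` on a path of least weight are adjacent, then one of them is a
collider of the path with an arrow to the other one. -/
theorem MinPath.shielded (hG : G.IsRCG) (h : G.MinPath C i j t (a :: L) (b :: R))
    (hab : G.Adj a b) :
    (∃ z ∈ L.head?, G.Points z a ∧ G.Points t a ∧ G.arrow a b ∧ a ∈ C) ∨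
      (∃ z ∈ R.head?, G.Points z b ∧ G.Points t b ∧ G.arrow b a ∧ b ∈ C) := by
  have ht := h.openAt a rfl b rfl
  by_contra! hn
  have hL : ∀ z ∈ L.head?, G.OpenAt C z a b := by
    intro z hz
    by_contra ho
    obtain ⟨h1, h2, h3, h4⟩ := hG.of_not_openAt (h.left.2.1 z hz).symm ht h.left.1.symm
      h.right.1 hab ho
    exact hn.1 z hz h1 h2 h3 h4
  have hR : ∀ z ∈ R.head?, G.OpenAt C z b a := by
    intro z hz
    by_contra ho
    obtain ⟨h1, h2, h3, h4⟩ := hG.of_not_openAt (h.right.2.1 z hz).symm ht.symm h.right.1.symm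
      h.left.1 hab.symm ho
    exact hn.2 z hz h1 h2 h3 h4
  have hp : G.OpenPath C i j a L (b :: R) := by
    refine ⟨h.left.2.2, ⟨hab, fun z hz => (hR z hz).symm, h.right.2.2⟩, ?_, ?_⟩
    · intro z hz b' hb'
      obtain rfl : b = b' := by simpa using hb'
      exact hL z hz
    · simpa using (List.nodup_cons.1 h.nodup).2
  have := h.le _ _ _ hp
  simp only [weight_cons, weight_append, List.cons_append] at this
  omega

/-- By `MinPath.shielded`, a triangle would make one edge at `t` an arrow out of `t`. -/
theorem MinPath.not_adj_of_collider (hG : G.IsRCG) (h : G.MinPath C i j t (a :: L) (b :: R))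
    (hc : G.Points a t ∧ G.Points b t) : ¬ G.Adj a b := by
  intro hab
  rcases h.shielded hG hab with ⟨z, -, -, hta, hab', -⟩ | ⟨z, -, -, htb, hba, -⟩
  · exact hG.not_points_of_arrow (hG.arrow_of_triangle hta hab' h.right.1) hc.2
  · exact hG.not_points_of_arrow (hG.arrow_of_triangle htb hba h.left.1) hc.1

end Minimal

/-! ### Transfer of least-weight open paths to the other graph -/

section Transfer

variable {V : Type*} {G₁ G₂ : LooplessMixedGraph V}

variable (G₁ G₂) in
/-- `G₁` and `G₂` are regression chain graphs with the same skeleton and the same unshielded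
colliders. -/
structure SameVees : Prop where
  left : G₁.IsRCG
  right : G₂.IsRCG
  adj : ∀ x y, G₁.Adj x y ↔ G₂.Adj x y
  collider : ∀ a t b, a ≠ b → ¬ G₁.Adj a b →
    (G₁.Points a t ∧ G₁.Points b t ↔ G₂.Points a t ∧ G₂.Points b t)

variable {C : Set V} {i j t a b d x q : V} {L R : List V}

theorem SameVees.symm (hs : SameVees G₁ G₂) : SameVees G₂ G₁ where
  left := hs.right
  right := hs.left
  adj x y := (hs.adj x y).symm
  collider a t b hab hadj := (hs.collider a t b hab fun h => hadj ((hs.adj _ _).1 h)).symm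

/-- Otherwise `q` would be an unshielded collider between `x` and `d` in `G₂`, hence in `G₁`. -/
theorem SameVees.arrow_of_not_adj (hs : SameVees G₁ G₂) (h₁ : G₁.Points x q) (h₂ : G₂.Points x q)
    (hq : G₁.arrow q d) (hadj : ¬ G₁.Adj x d) : G₂.arrow q d := by
  have hne : x ≠ d := by
    rintro rfl
    exact hs.left.not_points_of_arrow hq h₁
  by_contra hn
  have := hs.right.points_of_not_arrow h₂ ((hs.adj _ _).1 (adj_of_arrow hq)) hn
  exact hs.left.not_points_of_arrow hq ((hs.collider x q d hne hadj).2 ⟨h₂, this⟩).2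

/-- The argument along discriminating paths: an arrow `q → d` out of a node with an arrowhead of a
path of least weight is also present in the other graph, unless an earlier node of the path can
be joined directly to `d`. -/
theorem SameVees.arrow_or_shortcut (hs : SameVees G₁ G₂) (h : G₁.MinPath C i j q (x :: L) R)
    (h₁ : G₁.Points x q) (h₂ : G₂.Points x q) (hq : G₁.arrow q d) :
    G₂.arrow q d ∨
      ∃ y Q, (y :: Q).Sublist (x :: L) ∧ G₁.arrow y d ∧ G₁.OpenWalk C i d (y :: Q) := by
  induction L generalizing q x R with
  | nil =>
    by_cases hadj : G₁.Adj x d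
    · have hx := hs.left.arrow_of_triangle h₁ hq hadj
      exact .inr ⟨x, [], List.Sublist.refl _, hx, hadj.symm, by simp, h.left.2.2⟩
    · exact .inl (hs.arrow_of_not_adj h₁ h₂ hq hadj)
  | cons z L ih =>
    by_cases hadj : G₁.Adj x d
    · have hx := hs.left.arrow_of_triangle h₁ hq hadj
      -- With `x → d`, the node `x` would be a non-collider of a shortcut through it, so only `x ∈
      -- C` obstructs. Then `x` is a collider of the path, unshielded by minimality, and the
      -- argument repeats with `x` in place of `q`.
      by_cases hxC : x ∈ C
      · have hc : G₁.Points q x ∧ G₁.Points z x := by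
          by_contra hn
          exact (h.left.2.1 z rfl).2 hn hxC
        have h' := h.shift_left
        have hzq := h'.not_adj_of_collider hs.left hc.symm
        have hc₂ := (hs.collider z x q h'.toOpenPath.ne hzq).1 hc.symm
        rcases ih h' hc.2 hc₂.1 hx with hxd | ⟨y, Q, hQ, hy⟩
        · exact .inl (hs.right.arrow_of_triangle hc₂.2 hxd
            ((hs.adj _ _).1 (adj_of_arrow hq)))
        · exact .inr ⟨y, Q, hQ.trans (List.sublist_cons_self _ _), hy⟩
      · refine .inr ⟨x, z :: L, List.Sublist.refl _, hx, hadj.symm, fun w _ => ?_, h.left.2.2⟩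
        exact ⟨fun hc => absurd hc.1 (hs.left.not_points_of_arrow hx), fun _ => hxC⟩
    · exact .inl (hs.arrow_of_not_adj h₁ h₂ hq hadj)

/-- Either `a → b` survives and the triangle forces `t → b` in `G₂`, or a shortcut into `b` omits
`t` and `a`, against minimality. -/
theorem SameVees.not_points_of_shielded (hs : SameVees G₁ G₂)
    (h : G₁.MinPath C i j t (a :: L) (b :: R)) (hz : x ∈ L.head?) (hxa : G₁.Points x a)
    (hta : G₁.Points t a) (hab : G₁.arrow a b) : ¬ G₂.Points b t := by
  obtain ⟨L, rfl⟩ : ∃ L', L = x :: L' := by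
    cases L with
    | nil => simp at hz
    | cons y L => exact ⟨L, by simpa using hz⟩
  have h' := h.shift_left
  have hc := (hs.collider x a t h'.toOpenPath.ne
    (h'.not_adj_of_collider hs.left ⟨hxa, hta⟩)).1 ⟨hxa, hta⟩
  have htb := hs.left.arrow_of_triangle hta hab h.right.1
  rcases hs.arrow_or_shortcut h' hxa hc.1 hab with hab₂ | ⟨y, Q, hQ, hy, ho⟩
  · exact hs.right.not_points_of_arrow
      (hs.right.arrow_of_triangle hc.2 hab₂ ((hs.adj _ _).1 h.right.1))
  · exfalso
    have hn : ((y :: Q) ++ b :: R).Sublist (t :: (a :: x :: L ++ b :: R)) :=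
      ((hQ.append_right _).trans (List.sublist_cons_self _ _)).trans (List.sublist_cons_self _ _)
    have hp : G₁.OpenPath C i j b (y :: Q) R := by
      refine ⟨ho, h.right.2.2, ?_, ?_⟩
      · intro y' hy' r hr
        obtain rfl : y = y' := by simpa using hy'
        have := h.right.2.1 r hr
        -- The new predecessor `y` points to `b` just as `t` did, so the status of `b` is unchanged.
        exact ⟨fun hc => this.1 ⟨.inl htb, hc.2⟩, fun hc => this.2 fun hc' => hc ⟨.inl hy, hc'.2⟩⟩
      · exact List.perm_middle.nodup_iff.1 (h.nodup.sublist hn)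
    have h1 := h.le _ _ _ hp
    have h2 := weight_le_of_sublist (G := G₁) (C := C) hQ
    simp only [weight_cons, weight_append, List.cons_append] at h1 h2
    omega

theorem SameVees.collider_iff (hs : SameVees G₁ G₂)
    (h : G₁.MinPath C i j t (a :: L) (b :: R)) :
    G₁.Points a t ∧ G₁.Points b t ↔ G₂.Points a t ∧ G₂.Points b t := by
  by_cases hab : G₁.Adj a b
  · refine ⟨fun hc => absurd hab (h.not_adj_of_collider hs.left hc), fun hc => ?_⟩
    rcases h.shielded hs.left hab with ⟨z, hz, hza, hta, hab', -⟩ | ⟨z, hz, hzb, htb, hba, -⟩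
    · exact absurd hc.2 (hs.not_points_of_shielded h hz hza hta hab')
    · exact absurd hc.1 (hs.not_points_of_shielded h.symm hz hzb htb hba)
  · exact hs.collider a t b h.toOpenPath.ne hab

/-- Two successive arrows of a shortest chain have nonadjacent ends, for a third side would be an
arrow shortening the chain. So the arrows carry over one after another. -/
theorem SameVees.mem_closure_of_arrow (hs : SameVees G₁ G₂) (h₁ : G₁.arrow x t)
    (h₂ : G₂.arrow x t) (ht : t ∈ C ∪ G₁.ancestors C)
    (hd : G₁.depth C x = G₁.depth C t + 1) : t ∈ C ∪ G₂.ancestors C := by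
  generalize hn : G₁.depth C t = n at hd
  induction n generalizing x t with
  | zero =>
    have := reachesIn_depth ht
    rw [hn] at this
    cases this with
    | zero h => exact .inl h
  | succ n ih =>
    by_cases hC : t ∈ C
    · exact .inl hC
    obtain ⟨y, hy, hyC, hyd⟩ := exists_arrow_depth ht hC
    have hadj : ¬ G₁.Adj x y := by
      intro hadj
      have := depth_le_of_arrow (hs.left.arrow_of_triangle (.inl h₁) hy hadj) hyC
      omega
    have hy₂ := hs.arrow_of_not_adj (.inl h₁) (.inl h₂) hy hadj
    exact LooplessMixedGraph.mem_closure_of_arrow hy₂ (ih hy hy₂ hyC (by omega) (by omega))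

theorem SameVees.mem_closure (hs : SameVees G₁ G₂)
    (h : G₁.MinPath C i j t (a :: L) (b :: R)) (hc : G₁.Points a t ∧ G₁.Points b t) :
    t ∈ C ∪ G₂.ancestors C := by
  by_cases hC : t ∈ C
  · exact .inl hC
  have ht := (h.openAt a rfl b rfl).1 hc
  have hc₂ := (hs.collider_iff h).1 hc
  obtain ⟨d, hd, hdC, hdd⟩ := exists_arrow_depth ht hC
  suffices hd₂ : G₂.arrow t d from
    LooplessMixedGraph.mem_closure_of_arrow hd₂ (hs.mem_closure_of_arrow hd hd₂ hdC hdd)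
  rcases hs.arrow_or_shortcut h hc.1 hc₂.1 hd with hd₂ | ⟨y, Q, hQ, hy, ho⟩
  · exact hd₂
  rcases hs.arrow_or_shortcut h.symm hc.2 hc₂.2 hd with hd₂ | ⟨y', Q', hQ', hy', ho'⟩
  · exact hd₂
  exfalso
  have hn := (List.nodup_cons.1 h.nodup).2
  -- The node `d` may already lie on the path; each arm is then cut there so that `d` occurs only
  -- once.
  obtain ⟨P, hP, hPo, hdP, hPh⟩ := ho.exists_notMem (by simpa using .inl hy)
    (hn.of_append_left.sublist hQ)
  obtain ⟨P', hP', hPo', hdP', hPh'⟩ := ho'.exists_notMem (by simpa using .inl hy')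
    (hn.of_append_right.sublist hQ')
  have hp : G₁.OpenPath C i j d P P' := by
    refine ⟨hPo, hPo', fun u hu v hv => ⟨fun _ => hdC, fun hn hdC' => ?_⟩, ?_⟩
    · exact hn ⟨hPh hdC' u hu, hPh' hdC' v hv⟩
    · refine List.nodup_cons.2 ⟨by simp [hdP, hdP'], ?_⟩
      exact hn.sublist ((hP.trans hQ).append (hP'.trans hQ'))
  -- The arms got no heavier and `t` was replaced by `d`, whose depth is smaller by one.
  have h1 := h.le _ _ _ hp
  have h2 := weight_le_of_sublist (G := G₁) (C := C) (hP.trans hQ)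
  have h3 := weight_le_of_sublist (G := G₁) (C := C) (hP'.trans hQ')
  rw [weight_cons, weight_cons, weight_append, weight_append] at h1
  omega

theorem SameVees.openAt (hs : SameVees G₁ G₂) (h : G₁.MinPath C i j t (a :: L) (b :: R)) :
    G₂.OpenAt C a t b :=
  ⟨fun hc => hs.mem_closure h ((hs.collider_iff h).2 hc),
    fun hc => (h.openAt a rfl b rfl).2 fun hc' => hc ((hs.collider_iff h).1 hc')⟩

theorem SameVees.openWalk (hs : SameVees G₁ G₂) (h : G₁.MinPath C i j t L R) :
    G₂.OpenWalk C i t L := by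
  induction L generalizing t R with
  | nil => exact h.left
  | cons a L ih =>
    refine ⟨(hs.adj _ _).1 h.left.1, fun z hz => ?_, ih h.shift_left⟩
    cases L with
    | nil => simp at hz
    | cons y L =>
      obtain rfl : y = z := by simpa using hz
      exact (hs.openAt h.shift_left).symm

theorem SameVees.openPath (hs : SameVees G₁ G₂) (h : G₁.MinPath C i j t L R) :
    G₂.OpenPath C i j t L R where
  left := hs.openWalk h
  right := hs.openWalk h.symm
  openAt a ha b hb := by
    cases L with
    | nil => simp at ha
    | cons a' L =>
      cases R with
      | nil => simp at hb
      | cons b' R =>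
        obtain rfl : a' = a := by simpa using ha
        obtain rfl : b' = b := by simpa using hb
        exact hs.openAt h
  nodup := h.nodup

theorem OpenPath.exists_start {G : LooplessMixedGraph V} (h : G.OpenPath C i j t L R) :
    ∃ R', G.OpenPath C i j i [] R' := by
  induction L generalizing t R with
  | nil =>
    obtain rfl : t = i := h.left
    exact ⟨R, h⟩
  | cons a L ih => exact ih h.shift_left

theorem SameVees.exists_isMConnecting (hs : SameVees G₁ G₂)
    (h : ∃ p : G₁.Walk i j, p.IsMConnecting C) : ∃ p : G₂.Walk i j, p.IsMConnecting C := by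
  obtain ⟨R, hR⟩ := hs.left.exists_isMConnecting_iff.1 h
  obtain ⟨t, L, R, hm⟩ := hR.exists_minPath
  exact hs.right.exists_isMConnecting_iff.2 (hs.openPath hm).exists_start

theorem SameVees.markovEquivalent (hs : SameVees G₁ G₂) : MarkovEquivalent G₁ G₂ :=
  fun _ _ _ _ _ _ =>
    ⟨fun h i hi j hj hp => h i hi j hj (hs.symm.exists_isMConnecting hp),
      fun h i hi j hj hp => h i hi j hj (hs.exists_isMConnecting hp)⟩

theorem isRCG_of_or {G : LooplessMixedGraph V} (h : G.IsRCG ∨ G.IsBG ∨ G.IsUG ∨ G.IsDAG) :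
    G.IsRCG := by
  rcases h with h | h | h | h
  · exact h
  · exact h.isRCG
  · exact h.isRCG
  · exact h.isRCG

end Transfer

end LooplessMixedGraph

theorem mainTheorem6 {V : Type*} (G₁ G₂ : LooplessMixedGraph V)
    (h₁ : G₁.IsRCG ∨ G₁.IsBG ∨ G₁.IsUG ∨ G₁.IsDAG)
    (h₂ : G₂.IsRCG ∨ G₂.IsBG ∨ G₂.IsUG ∨ G₂.IsDAG) :
    LooplessMixedGraph.MarkovEquivalent G₁ G₂ ↔
      G₁.skeleton = G₂.skeleton ∧ G₁.unshieldedColliders = G₂.unshieldedColliders := by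
  have r₁ := LooplessMixedGraph.isRCG_of_or h₁
  have r₂ := LooplessMixedGraph.isRCG_of_or h₂
  constructor
  · intro h
    refine ⟨?_, (h.unshieldedColliders_subset r₁ r₂).antisymm
      (h.symm.unshieldedColliders_subset r₂ r₁)⟩
    ext x y
    exact ⟨fun hxy => h.symm.adj r₂ hxy, fun hxy => h.adj r₁ hxy⟩
  · rintro ⟨hsk, huc⟩
    have hadj : ∀ x y, G₁.Adj x y ↔ G₂.Adj x y := fun x y => by
      change G₁.skeleton.Adj x y ↔ G₂.skeleton.Adj x y
      rw [hsk]
    refine LooplessMixedGraph.SameVees.markovEquivalent ⟨r₁, r₂, hadj, fun a t b hab hn => ?_⟩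
    have := r₁.mem_unshieldedColliders (i := a) (t := t) (j := b)
    rw [huc, r₂.mem_unshieldedColliders, ← hadj] at this
    tauto
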